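/- For a square complex matrix $X$ let $X^*$ be its conjugate transpose and $\mathrm{Re}(X)=\tfrac12(X+X^*)$. For $X\in M_m(\mathbb{C})$ with singular values $s_1(X),\dots,s_m(X)$ (counted with multiplicity) and $p\in[1,\infty)$, let $\|X\|_p=\bigl(\sum_{i=1}^m s_i(X)^p\bigr)^{1/p}$ be the Schatten $p$-norm, and let $$w_p(X)=\sup_{\theta\in\mathbb{R}}\bigl\|\mathrm{Re}(e^{i\theta}X)\bigr\|_p$$ be the corresponding generalized numerical radius; write $w_p^p(X)=(w_p(X))^p$. **Theorem 1.2.** Let $A,B,C,D\in M_n(\mathbb{C})$ and $T=\begin{bmatrix}A&B\\C&D\end{bmatrix}\in M_{2n}(\mathbb{C})$. Then for every $p\in[2,\infty)$, $$w_p^p(T)\le \frac{1}{2^{2-p}}\Bigl(w_p^p(A)+w_p^p(D)+\frac{1}{2^{p-1}}\bigl(\|B\|_p+\|C\|_p\bigr)^p\Bigr).$$ Moreover, for every $p\in[1,2]$, $$w_p^p(T)\le w_p^p(A)+w_p^p(D)+\frac{1}{2^{p-1}}\bigl(\|B\|_p+\|C\|_p\bigr)^p.$$ -/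

import Mathlib

open scoped ComplexStarModule

/-- The Schatten `p`-norm `‖A‖_p = (∑ᵢ sᵢ(A)^p)^(1/p)` of a square complex matrix, where the
`sᵢ(A)` are the singular values of `A`, listed with multiplicity (one for each dimension),
as an operator on the Euclidean space `ℂ^ι`. -/
noncomputable def schattenNorm {ι : Type*} [Fintype ι] [DecidableEq ι]
    (p : ℝ) (A : Matrix ι ι ℂ) : ℝ :=
  (∑ i ∈ Finset.range (Fintype.card ι),
    (Matrix.toEuclideanLin A).singularValues i ^ p) ^ (1 / p)

/-- The generalized numerical radius `w_N(A) = sup_θ N(Re(e^{iθ} A))`, where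
`Re X = (X + X*) / 2` is the Hermitian part of a matrix. -/
noncomputable def genNumericalRadius {ι : Type*} (N : Matrix ι ι ℂ → ℝ)
    (A : Matrix ι ι ℂ) : ℝ :=
  ⨆ θ : ℝ, N (ℜ (Complex.exp (θ * Complex.I) • A) : Matrix ι ι ℂ)

/-- The numerical radius `w_p` generalized by the Schatten `p`-norm. -/
noncomputable def schattenNumericalRadius {ι : Type*} [Fintype ι] [DecidableEq ι]
    (p : ℝ) (A : Matrix ι ι ℂ) : ℝ :=
  genNumericalRadius (schattenNorm p) A

open scoped InnerProductSpace

/-! For |z| = 1, Re(zT) has diagonal blocks Re(zA), Re(zD) and off-diagonal blocks K, K* with K =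
(zB + (zC)*)/2, so ‖K‖_p ≤ (‖B‖_p + ‖C‖_p)/2. It remains to bound ‖·‖_p^p of a block matrix by the
sum over its four blocks, with constant 1 if p ≤ 2 and 2^(p-2) if p ≥ 2.

Both bounds come from ‖Tx‖² being, for unit x, an average of the squared singular values; Jensen for
t^(p/2) then compares ∑ ‖T xᵢ‖^p with ∑ sⱼ^p, in a direction fixed by the sign of p - 2. The
triangle inequality and invariance under adjoints come from the variational bound
`sum_norm_inner_rpow_le_schattenSum`, attained at singular vectors. -/

/-! ### Jensen inequalities for stochastic weights. -/

theorem Finset.sum_rpow_sum_mul_le_of_substochastic {κ ι : Type*} [Fintype κ] [Fintype ι] {p : ℝ}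
    (hp : 1 ≤ p) (w : κ → ι → ℝ) (a : ι → ℝ) (hw : ∀ i j, 0 ≤ w i j) (ha : ∀ j, 0 ≤ a j)
    (hrow : ∀ i, ∑ j, w i j ≤ 1) (hcol : ∀ j, ∑ i, w i j ≤ 1) :
    ∑ i, (∑ j, w i j * a j) ^ p ≤ ∑ j, a j ^ p := by
  have hp0 : 0 < p := by linarith
  have key : ∀ i, (∑ j, w i j * a j) ^ p ≤ ∑ j, w i j * a j ^ p := by
    intro i
    have h0 : 0 ≤ ∑ j, w i j * a j ^ p :=
      Finset.sum_nonneg fun j _ => mul_nonneg (hw i j) (Real.rpow_nonneg (ha j) p)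
    have h1 : ∑ j, w i j * a j ≤ (∑ j, w i j * a j ^ p) ^ p⁻¹ := by
      refine (Real.inner_le_weight_mul_Lp_of_nonneg Finset.univ hp (w i) a (hw i) ha).trans ?_
      refine mul_le_of_le_one_left (Real.rpow_nonneg h0 _) ?_
      exact Real.rpow_le_one (Finset.sum_nonneg fun j _ => hw i j) (hrow i)
        (sub_nonneg.2 (inv_le_one_of_one_le₀ hp))
    calc (∑ j, w i j * a j) ^ p ≤ ((∑ j, w i j * a j ^ p) ^ p⁻¹) ^ p :=
          Real.rpow_le_rpow (Finset.sum_nonneg fun j _ => mul_nonneg (hw i j) (ha j)) h1 hp0.le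
      _ = _ := Real.rpow_inv_rpow h0 hp0.ne'
  calc ∑ i, (∑ j, w i j * a j) ^ p ≤ ∑ i, ∑ j, w i j * a j ^ p := Finset.sum_le_sum fun i _ => key i
    _ = ∑ j, (∑ i, w i j) * a j ^ p := by
        rw [Finset.sum_comm]; simp_rw [Finset.sum_mul]
    _ ≤ ∑ j, a j ^ p := Finset.sum_le_sum fun j _ =>
        mul_le_of_le_one_left (Real.rpow_nonneg (ha j) p) (hcol j)

theorem Finset.sum_rpow_le_sum_rpow_sum_mul {κ ι : Type*} [Fintype κ] [Fintype ι] {r : ℝ}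
    (hr : 0 ≤ r) (hr1 : r ≤ 1) (w : κ → ι → ℝ) (a : ι → ℝ) (hw : ∀ i j, 0 ≤ w i j)
    (ha : ∀ j, 0 ≤ a j) (hrow : ∀ i, ∑ j, w i j = 1) (hcol : ∀ j, ∑ i, w i j = 1) :
    ∑ j, a j ^ r ≤ ∑ i, (∑ j, w i j * a j) ^ r := by
  have key : ∀ i, ∑ j, w i j * a j ^ r ≤ (∑ j, w i j * a j) ^ r := by
    intro i
    simpa using (Real.concaveOn_rpow hr hr1).le_map_sum (t := Finset.univ) (w := w i) (p := a)
      (fun j _ => hw i j) (hrow i) (fun j _ => ha j)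
  calc ∑ j, a j ^ r = ∑ j, (∑ i, w i j) * a j ^ r := by simp [hcol]
    _ = ∑ i, ∑ j, w i j * a j ^ r := by rw [Finset.sum_comm]; simp_rw [Finset.sum_mul]
    _ ≤ _ := Finset.sum_le_sum fun i _ => key i

theorem Real.add_rpow_le_two_rpow_mul {a b r : ℝ} (ha : 0 ≤ a) (hb : 0 ≤ b) (hr : 1 ≤ r) :
    (a + b) ^ r ≤ 2 ^ (r - 1) * (a ^ r + b ^ r) := by
  lift a to NNReal using ha
  lift b to NNReal using hb
  exact_mod_cast NNReal.rpow_add_le_mul_rpow_add_rpow a b hr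

/-! ### Singular vectors and Schatten sums. -/

namespace LinearMap

variable {E : Type*} [NormedAddCommGroup E] [InnerProductSpace ℂ E] [FiniteDimensional ℂ E]
  {F : Type*} [NormedAddCommGroup F] [InnerProductSpace ℂ F] [FiniteDimensional ℂ F]

/-- The sum of the `p`-th powers of the singular values of a linear map, one singular value for
each dimension of the domain. -/
noncomputable def schattenSum (p : ℝ) (T : E →ₗ[ℂ] F) : ℝ :=
  ∑ i : Fin (Module.finrank ℂ E), T.singularValues i ^ p

theorem schattenSum_nonneg (p : ℝ) (T : E →ₗ[ℂ] F) : 0 ≤ T.schattenSum p :=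
  Finset.sum_nonneg fun i _ => Real.rpow_nonneg (T.singularValues_nonneg i) p

/-- The right singular vectors of a linear map. -/
noncomputable def rightSingularBasis (T : E →ₗ[ℂ] F) :
    OrthonormalBasis (Fin (Module.finrank ℂ E)) ℂ E :=
  T.isSymmetric_adjoint_comp_self.eigenvectorBasis rfl

theorem adjoint_apply_rightSingularBasis (T : E →ₗ[ℂ] F) (i : Fin (Module.finrank ℂ E)) :
    adjoint T (T (T.rightSingularBasis i)) =
      ((T.singularValues i : ℂ) ^ 2) • T.rightSingularBasis i := by
  have h := T.isSymmetric_adjoint_comp_self.apply_eigenvectorBasis rfl i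
  rw [← T.sq_singularValues_fin rfl i] at h
  rw [comp_apply] at h
  rw [rightSingularBasis, h]
  simp

theorem inner_map_rightSingularBasis (T : E →ₗ[ℂ] F) (i : Fin (Module.finrank ℂ E)) (x : E) :
    ⟪T (T.rightSingularBasis i), T x⟫_ℂ =
      (T.singularValues i : ℂ) ^ 2 * ⟪T.rightSingularBasis i, x⟫_ℂ := by
  rw [← adjoint_inner_left, adjoint_apply_rightSingularBasis, inner_smul_left]
  simp

theorem norm_map_rightSingularBasis (T : E →ₗ[ℂ] F) (i : Fin (Module.finrank ℂ E)) :
    ‖T (T.rightSingularBasis i)‖ = T.singularValues i := by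
  have h := T.inner_map_rightSingularBasis i (T.rightSingularBasis i)
  rw [inner_self_eq_norm_sq_to_K, inner_self_eq_norm_sq_to_K, T.rightSingularBasis.norm_eq_one] at h
  have h2 : ‖T (T.rightSingularBasis i)‖ ^ 2 = T.singularValues i ^ 2 := by
    simp at h
    exact_mod_cast h
  exact (sq_eq_sq₀ (norm_nonneg _) (T.singularValues_nonneg _)).1 h2

/-- Parseval in an eigenbasis of T*T. For unit x the weights sum to 1, which is what Jensen needs.
-/
theorem norm_map_sq (T : E →ₗ[ℂ] F) (x : E) :
    ‖T x‖ ^ 2 = ∑ j : Fin (Module.finrank ℂ E),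
      ‖⟪T.rightSingularBasis j, x⟫_ℂ‖ ^ 2 * T.singularValues j ^ 2 := by
  have h : ⟪T x, T x⟫_ℂ = ∑ j : Fin (Module.finrank ℂ E),
      ((‖⟪T.rightSingularBasis j, x⟫_ℂ‖ ^ 2 * T.singularValues j ^ 2 : ℝ) : ℂ) := by
    rw [← adjoint_inner_left, ← T.rightSingularBasis.sum_inner_mul_inner]
    refine Finset.sum_congr rfl fun j _ => ?_
    rw [adjoint_inner_left, ← inner_conj_symm, inner_map_rightSingularBasis]
    push_cast
    rw [← Complex.conj_mul']
    simp
    ring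
  rw [inner_self_eq_norm_sq_to_K, ← Complex.ofReal_sum] at h
  exact Complex.ofReal_injective (by simpa using h)

/-- For `p ≤ 2`, the Schatten sum is at most the sum of `‖T xᵢ‖ ^ p` over a tight frame of unit
vectors. -/
theorem schattenSum_le_sum_norm_rpow {κ : Type*} [Fintype κ] {p : ℝ} (hp : 0 ≤ p) (hp2 : p ≤ 2)
    (T : E →ₗ[ℂ] F) (x : κ → E) (hx : ∀ i, ‖x i‖ = 1)
    (hframe : ∀ y, ∑ i, ‖⟪y, x i⟫_ℂ‖ ^ 2 = ‖y‖ ^ 2) :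
    T.schattenSum p ≤ ∑ i, ‖T (x i)‖ ^ p := by
  have h := Finset.sum_rpow_le_sum_rpow_sum_mul (r := p / 2) (by linarith) (by linarith)
    (fun i (j : Fin (Module.finrank ℂ E)) => ‖⟪T.rightSingularBasis j, x i⟫_ℂ‖ ^ 2)
    (fun j => T.singularValues j ^ 2) (fun _ _ => by positivity) (fun _ => by positivity)
    (fun i => by rw [T.rightSingularBasis.sum_sq_norm_inner_right, hx, one_pow])
    (fun j => by rw [hframe, T.rightSingularBasis.norm_eq_one, one_pow])
  have e : ∀ a : ℝ, 0 ≤ a → (a ^ 2) ^ (p / 2) = a ^ p := fun a ha => by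
    rw [← Real.rpow_natCast_mul ha]; congr 1; push_cast; ring
  simp_rw [← norm_map_sq, e _ (norm_nonneg _), e _ (T.singularValues_nonneg _)] at h
  exact h

/-- For `2 ≤ p`, the Schatten sum is at least the sum of `‖T xᵢ‖ ^ p` over an orthonormal basis. -/
theorem sum_norm_rpow_le_schattenSum {κ : Type*} [Fintype κ] {p : ℝ} (hp : 2 ≤ p)
    (T : E →ₗ[ℂ] F) (x : OrthonormalBasis κ ℂ E) :
    ∑ i, ‖T (x i)‖ ^ p ≤ T.schattenSum p := by
  have h := Finset.sum_rpow_sum_mul_le_of_substochastic (p := p / 2) (by linarith)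
    (fun i (j : Fin (Module.finrank ℂ E)) => ‖⟪T.rightSingularBasis j, x i⟫_ℂ‖ ^ 2)
    (fun j => T.singularValues j ^ 2) (fun _ _ => by positivity) (fun _ => by positivity)
    (fun i => by rw [T.rightSingularBasis.sum_sq_norm_inner_right, x.norm_eq_one, one_pow])
    (fun j => by rw [x.sum_sq_norm_inner_left, T.rightSingularBasis.norm_eq_one, one_pow])
  have e : ∀ a : ℝ, 0 ≤ a → (a ^ 2) ^ (p / 2) = a ^ p := fun a ha => by
    rw [← Real.rpow_natCast_mul ha]; congr 1; push_cast; ring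
  simp_rw [← norm_map_sq, e _ (norm_nonneg _), e _ (T.singularValues_nonneg _)] at h
  exact h

/-- The left singular vectors of a linear map, with value `0` where the singular value vanishes. -/
noncomputable def leftSingularVector (T : E →ₗ[ℂ] F) (i : Fin (Module.finrank ℂ E)) : F :=
  ((T.singularValues i : ℂ)⁻¹) • T (T.rightSingularBasis i)

theorem map_rightSingularBasis (T : E →ₗ[ℂ] F) (i : Fin (Module.finrank ℂ E)) :
    T (T.rightSingularBasis i) = (T.singularValues i : ℂ) • T.leftSingularVector i := by
  by_cases h : T.singularValues i = 0
  · have := T.norm_map_rightSingularBasis i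
    rw [h, norm_eq_zero] at this
    simp [h, this]
  · rw [leftSingularVector, smul_smul, mul_inv_cancel₀ (by exact_mod_cast h), one_smul]

theorem leftSingularVector_eq_zero {T : E →ₗ[ℂ] F} {i : Fin (Module.finrank ℂ E)}
    (h : T.singularValues i = 0) : T.leftSingularVector i = 0 := by
  simp [leftSingularVector, h]

theorem orthonormal_leftSingularVector (T : E →ₗ[ℂ] F) :
    Orthonormal ℂ fun i : {i : Fin (Module.finrank ℂ E) // T.singularValues i ≠ 0} =>
      T.leftSingularVector i := by
  classical
  rw [orthonormal_iff_ite]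
  rintro ⟨i, hi⟩ ⟨j, hj⟩
  have hi' : (T.singularValues i : ℂ) ≠ 0 := by exact_mod_cast hi
  simp only [leftSingularVector, inner_smul_left, inner_smul_right, inner_map_rightSingularBasis,
    orthonormal_iff_ite.1 T.rightSingularBasis.orthonormal, Subtype.mk.injEq]
  split_ifs with h
  · subst h
    simp
    field_simp
  · simp

theorem norm_leftSingularVector_le (T : E →ₗ[ℂ] F) (i : Fin (Module.finrank ℂ E)) :
    ‖T.leftSingularVector i‖ ≤ 1 := by
  by_cases h : T.singularValues i = 0
  · simp [leftSingularVector_eq_zero h]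
  · exact (T.orthonormal_leftSingularVector.1 ⟨i, h⟩).le

theorem sum_subtype_singularValues_ne_zero (T : E →ₗ[ℂ] F) {g : Fin (Module.finrank ℂ E) → ℝ}
    (hg : ∀ i : Fin (Module.finrank ℂ E), T.singularValues i = 0 → g i = 0) :
    ∑ i : {i : Fin (Module.finrank ℂ E) // T.singularValues i ≠ 0}, g i = ∑ i, g i := by
  rw [← Fintype.sum_subtype_add_sum_subtype
    (fun i : Fin (Module.finrank ℂ E) => T.singularValues i ≠ 0) g]
  simp only [left_eq_add]
  exact Finset.sum_eq_zero fun i _ => hg i (not_not.1 i.2)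

theorem sum_norm_inner_leftSingularVector_le (T : E →ₗ[ℂ] F) (y : F) :
    ∑ i, ‖⟪T.leftSingularVector i, y⟫_ℂ‖ ^ 2 ≤ ‖y‖ ^ 2 := by
  rw [← T.sum_subtype_singularValues_ne_zero fun i hi => by simp [leftSingularVector_eq_zero hi]]
  exact T.orthonormal_leftSingularVector.sum_inner_products_le (s := Finset.univ) y

theorem map_eq_sum_leftSingularVector (T : E →ₗ[ℂ] F) (x : E) :
    T x = ∑ j, (⟪T.rightSingularBasis j, x⟫_ℂ * T.singularValues j) • T.leftSingularVector j := by
  conv_lhs => rw [← T.rightSingularBasis.sum_repr' x]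
  simp only [map_sum, map_smul, map_rightSingularBasis, smul_smul]

/-- Expanding T in its singular vectors and applying AM-GM to each product of coefficients gives
weights that are substochastic by Parseval and Bessel. -/
theorem sum_norm_inner_rpow_le_schattenSum {κ : Type*} [Fintype κ] {p : ℝ} (hp : 1 ≤ p)
    (T : E →ₗ[ℂ] F) {e : κ → E} {f : κ → F} (he : Orthonormal ℂ e) (hf : Orthonormal ℂ f) :
    ∑ i, ‖⟪f i, T (e i)⟫_ℂ‖ ^ p ≤ T.schattenSum p := by
  have h := Finset.sum_rpow_sum_mul_le_of_substochastic hp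
    (fun i (j : Fin (Module.finrank ℂ E)) => (‖⟪T.rightSingularBasis j, e i⟫_ℂ‖ ^ 2 +
      ‖⟪T.leftSingularVector j, f i⟫_ℂ‖ ^ 2) / 2)
    (fun j => T.singularValues j) (fun _ _ => by positivity) (fun _ => T.singularValues_nonneg _)
    (fun i => by
      have h1 := T.rightSingularBasis.sum_sq_norm_inner_right (e i)
      have h2 := T.sum_norm_inner_leftSingularVector_le (f i)
      rw [he.1] at h1
      rw [hf.1] at h2
      rw [← Finset.sum_div, Finset.sum_add_distrib]
      linarith)
    (fun j => by
      have h1 := he.sum_inner_products_le (s := Finset.univ) (T.rightSingularBasis j)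
      have h2 := hf.sum_inner_products_le (s := Finset.univ) (T.leftSingularVector j)
      rw [T.rightSingularBasis.norm_eq_one] at h1
      have h3 := pow_le_one₀ (n := 2) (norm_nonneg _) (T.norm_leftSingularVector_le j)
      simp_rw [norm_inner_symm (e _)] at h1
      simp_rw [norm_inner_symm (f _)] at h2
      rw [← Finset.sum_div, Finset.sum_add_distrib]
      linarith)
  refine le_trans (Finset.sum_le_sum fun i _ => ?_) h
  refine Real.rpow_le_rpow (norm_nonneg _) ?_ (by linarith)
  rw [map_eq_sum_leftSingularVector, inner_sum]
  refine (norm_sum_le _ _).trans (Finset.sum_le_sum fun j _ => ?_)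
  rw [inner_smul_right, norm_mul, norm_mul, norm_inner_symm (f i), Complex.norm_real,
    Real.norm_of_nonneg (T.singularValues_nonneg _)]
  nlinarith [mul_nonneg (T.singularValues_nonneg j)
    (sq_nonneg (‖⟪T.rightSingularBasis j, e i⟫_ℂ‖ - ‖⟪T.leftSingularVector j, f i⟫_ℂ‖))]

/-- The variational bound is attained. Discarding zero singular values keeps the left vectors
orthonormal and costs nothing, as 0^p = 0. -/
theorem schattenSum_eq_sum_norm_inner_rpow {p : ℝ} (hp : p ≠ 0) (T : E →ₗ[ℂ] F) :
    T.schattenSum p = ∑ i : {i : Fin (Module.finrank ℂ E) // T.singularValues i ≠ 0},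
      ‖⟪T.leftSingularVector i, T (T.rightSingularBasis i)⟫_ℂ‖ ^ p := by
  rw [T.sum_subtype_singularValues_ne_zero
    (g := fun i => ‖⟪T.leftSingularVector i, T (T.rightSingularBasis i)⟫_ℂ‖ ^ p)
    fun i hi => by simp [leftSingularVector_eq_zero hi, hp]]
  refine Finset.sum_congr rfl fun i _ => ?_
  by_cases hi : T.singularValues i = 0
  · simp [leftSingularVector_eq_zero hi, hi]
  · rw [map_rightSingularBasis, inner_smul_right, norm_mul, Complex.norm_real,
      Real.norm_of_nonneg (T.singularValues_nonneg _),
      inner_self_eq_norm_sq_to_K, T.orthonormal_leftSingularVector.1 ⟨i, hi⟩]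
    simp

theorem orthonormal_rightSingularBasis_subtype (T : E →ₗ[ℂ] F) :
    Orthonormal ℂ fun i : {i : Fin (Module.finrank ℂ E) // T.singularValues i ≠ 0} =>
      T.rightSingularBasis i :=
  T.rightSingularBasis.orthonormal.comp _ Subtype.val_injective

/-- The extremal families of T, swapped, are test families for T*. -/
theorem schattenSum_le_schattenSum_adjoint {p : ℝ} (hp : 1 ≤ p) (T : E →ₗ[ℂ] F) :
    T.schattenSum p ≤ (adjoint T).schattenSum p := by
  rw [schattenSum_eq_sum_norm_inner_rpow (by linarith)]
  refine le_trans (le_of_eq ?_) (sum_norm_inner_rpow_le_schattenSum hp (adjoint T)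
    T.orthonormal_leftSingularVector T.orthonormal_rightSingularBasis_subtype)
  refine Finset.sum_congr rfl fun i _ => ?_
  rw [adjoint_inner_right, norm_inner_symm]

theorem schattenSum_adjoint {p : ℝ} (hp : 1 ≤ p) (T : E →ₗ[ℂ] F) :
    (adjoint T).schattenSum p = T.schattenSum p := by
  refine le_antisymm ?_ (T.schattenSum_le_schattenSum_adjoint hp)
  simpa using (adjoint T).schattenSum_le_schattenSum_adjoint hp

theorem schattenSum_smul_le {p : ℝ} (hp : 1 ≤ p) (c : ℂ) (T : E →ₗ[ℂ] F) :
    (c • T).schattenSum p ≤ ‖c‖ ^ p * T.schattenSum p := by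
  rw [schattenSum_eq_sum_norm_inner_rpow (by linarith)]
  refine le_trans (le_of_eq ?_) (mul_le_mul_of_nonneg_left (sum_norm_inner_rpow_le_schattenSum hp T
    (c • T).orthonormal_rightSingularBasis_subtype (c • T).orthonormal_leftSingularVector)
    (Real.rpow_nonneg (norm_nonneg c) p))
  rw [Finset.mul_sum]
  refine Finset.sum_congr rfl fun i _ => ?_
  rw [smul_apply, inner_smul_right, norm_mul, Real.mul_rpow (norm_nonneg _) (norm_nonneg _)]

/-- Minkowski in ℓ^p, with the extremal families of T + U used as test families for T and U. -/
theorem schattenSum_add_rpow_le {p : ℝ} (hp : 1 ≤ p) (T U : E →ₗ[ℂ] F) :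
    (T + U).schattenSum p ^ (1 / p) ≤ T.schattenSum p ^ (1 / p) + U.schattenSum p ^ (1 / p) := by
  have hp0 : 0 < p := by linarith
  set e := fun i : {i : Fin (Module.finrank ℂ E) // (T + U).singularValues i ≠ 0} =>
    (T + U).rightSingularBasis i
  set f := fun i : {i : Fin (Module.finrank ℂ E) // (T + U).singularValues i ≠ 0} =>
    (T + U).leftSingularVector i
  have he : Orthonormal ℂ e := (T + U).orthonormal_rightSingularBasis_subtype
  have hf : Orthonormal ℂ f := (T + U).orthonormal_leftSingularVector
  have hnn : ∀ V : E →ₗ[ℂ] F, 0 ≤ ∑ i, ‖⟪f i, V (e i)⟫_ℂ‖ ^ p := fun V =>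
    Finset.sum_nonneg fun i _ => Real.rpow_nonneg (norm_nonneg _) p
  calc (T + U).schattenSum p ^ (1 / p)
      = (∑ i, ‖⟪f i, (T + U) (e i)⟫_ℂ‖ ^ p) ^ (1 / p) := by
        rw [schattenSum_eq_sum_norm_inner_rpow hp0.ne']
    _ ≤ (∑ i, (‖⟪f i, T (e i)⟫_ℂ‖ + ‖⟪f i, U (e i)⟫_ℂ‖) ^ p) ^ (1 / p) := by
        refine Real.rpow_le_rpow (hnn _) (Finset.sum_le_sum fun i _ => ?_) (by positivity)
        refine Real.rpow_le_rpow (norm_nonneg _) ?_ hp0.le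
        rw [add_apply, inner_add_right]
        exact norm_add_le _ _
    _ ≤ (∑ i, ‖⟪f i, T (e i)⟫_ℂ‖ ^ p) ^ (1 / p) + (∑ i, ‖⟪f i, U (e i)⟫_ℂ‖ ^ p) ^ (1 / p) :=
        Real.Lp_add_le_of_nonneg Finset.univ hp (fun _ _ => norm_nonneg _) fun _ _ => norm_nonneg _
    _ ≤ _ := add_le_add
        (Real.rpow_le_rpow (hnn T) (sum_norm_inner_rpow_le_schattenSum hp T he hf) (by positivity))
        (Real.rpow_le_rpow (hnn U) (sum_norm_inner_rpow_le_schattenSum hp U he hf) (by positivity))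

end LinearMap

/-! ### Schatten sums of block matrices. -/

namespace Matrix

theorem norm_toLp_sumElim_sq {m n : Type*} [Fintype m] [Fintype n] (a : m → ℂ)
    (b : n → ℂ) :
    ‖WithLp.toLp 2 (Sum.elim a b)‖ ^ 2 = ‖WithLp.toLp 2 a‖ ^ 2 + ‖WithLp.toLp 2 b‖ ^ 2 := by
  simp [EuclideanSpace.norm_sq_eq]

theorem inner_toLp_sumElim {m n : Type*} [Fintype m] [Fintype n]
    (y : EuclideanSpace ℂ (m ⊕ n)) (a : m → ℂ) (b : n → ℂ) :
    ⟪y, WithLp.toLp 2 (Sum.elim a b)⟫_ℂ =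
      ⟪WithLp.toLp 2 fun i => y (Sum.inl i), WithLp.toLp 2 a⟫_ℂ +
        ⟪WithLp.toLp 2 fun i => y (Sum.inr i), WithLp.toLp 2 b⟫_ℂ := by
  simp [PiLp.inner_apply]

variable {l m n : Type*} [Fintype l] [Fintype m] [DecidableEq m]
  [Fintype n] [DecidableEq n]

theorem schattenSum_conjTranspose {p : ℝ} (hp : 1 ≤ p) (X : Matrix m n ℂ) :
    (toEuclideanLin Xᴴ).schattenSum p = (toEuclideanLin X).schattenSum p := by
  rw [toEuclideanLin_conjTranspose_eq_adjoint, LinearMap.schattenSum_adjoint hp]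

theorem schattenSum_fromCols_le {p : ℝ} (hp : 0 ≤ p) (hp2 : p ≤ 2) (X : Matrix l m ℂ)
    (Y : Matrix l n ℂ) :
    (toEuclideanLin (fromCols X Y)).schattenSum p ≤
      (toEuclideanLin X).schattenSum p + (toEuclideanLin Y).schattenSum p := by
  set v := (toEuclideanLin X).rightSingularBasis
  set w := (toEuclideanLin Y).rightSingularBasis
  -- The zero-padded singular bases of X and Y form a tight frame on which the norms of the images
  -- are exactly the singular values of X and Y.
  have h := (toEuclideanLin (fromCols X Y)).schattenSum_le_sum_norm_rpow hp hp2
    (Sum.elim (fun i => WithLp.toLp 2 (Sum.elim (WithLp.ofLp (v i)) 0))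
      fun j => WithLp.toLp 2 (Sum.elim 0 (WithLp.ofLp (w j)))) ?_ ?_
  · refine h.trans (le_of_eq ?_)
    rw [Fintype.sum_sum_type]
    congr 1 <;> refine Finset.sum_congr rfl fun i _ => ?_
    · rw [← (toEuclideanLin X).norm_map_rightSingularBasis i]
      simp [toLpLin_apply, v]
    · rw [← (toEuclideanLin Y).norm_map_rightSingularBasis i]
      simp [toLpLin_apply, w]
  · rintro (i | j)
    · rw [← sq_eq_sq₀ (norm_nonneg _) zero_le_one, Sum.elim_inl, norm_toLp_sumElim_sq]
      simp
    · rw [← sq_eq_sq₀ (norm_nonneg _) zero_le_one, Sum.elim_inr, norm_toLp_sumElim_sq]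
      simp
  · intro y
    rw [Fintype.sum_sum_type]
    simp only [Sum.elim_inl, Sum.elim_inr, inner_toLp_sumElim, WithLp.toLp_ofLp, WithLp.toLp_zero,
      inner_zero_right, add_zero, zero_add, OrthonormalBasis.sum_sq_norm_inner_left]
    simp [EuclideanSpace.norm_sq_eq]

/-- On singular vectors v of the stack, ‖Xv‖² + ‖Yv‖² is the squared singular value; the power mean
inequality with exponent p/2 gives the constant. -/
theorem schattenSum_fromRows_le {l m n : Type*} [Fintype l] [DecidableEq l] [Fintype m]
    [Fintype n] {p : ℝ} (hp : 2 ≤ p) (X : Matrix m l ℂ)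
    (Y : Matrix n l ℂ) :
    (toEuclideanLin (fromRows X Y)).schattenSum p ≤ 2 ^ (p / 2 - 1) *
      ((toEuclideanLin X).schattenSum p + (toEuclideanLin Y).schattenSum p) := by
  set v := (toEuclideanLin (fromRows X Y)).rightSingularBasis
  have e : ∀ a : ℝ, 0 ≤ a → (a ^ 2) ^ (p / 2) = a ^ p := fun a ha => by
    rw [← Real.rpow_natCast_mul ha]; congr 1; push_cast; ring
  calc (toEuclideanLin (fromRows X Y)).schattenSum p
      = ∑ i, ‖toEuclideanLin (fromRows X Y) (v i)‖ ^ p :=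
        Finset.sum_congr rfl fun i _ => by rw [LinearMap.norm_map_rightSingularBasis]
    _ ≤ ∑ i, 2 ^ (p / 2 - 1) * (‖toEuclideanLin X (v i)‖ ^ p + ‖toEuclideanLin Y (v i)‖ ^ p) := by
        refine Finset.sum_le_sum fun i _ => ?_
        have h := Real.add_rpow_le_two_rpow_mul (sq_nonneg ‖toEuclideanLin X (v i)‖)
          (sq_nonneg ‖toEuclideanLin Y (v i)‖) (r := p / 2) (by linarith)
        rw [e _ (norm_nonneg _), e _ (norm_nonneg _), toLpLin_apply 2 2 X,
          toLpLin_apply 2 2 Y, ← norm_toLp_sumElim_sq, ← fromRows_mulVec, e _ (norm_nonneg _)]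
          at h
        exact h
    _ ≤ _ := by
        rw [← Finset.mul_sum, Finset.sum_add_distrib]
        gcongr <;> exact LinearMap.sum_norm_rpow_le_schattenSum hp _ v

theorem schattenSum_fromBlocks_le {p : ℝ} (hp : 1 ≤ p) (hp2 : p ≤ 2) (A B C D : Matrix n n ℂ) :
    (toEuclideanLin (fromBlocks A B C D)).schattenSum p ≤
      (toEuclideanLin A).schattenSum p + (toEuclideanLin B).schattenSum p +
        ((toEuclideanLin C).schattenSum p + (toEuclideanLin D).schattenSum p) := by
  have hcol := fun X Y : Matrix n n ℂ => schattenSum_fromCols_le (by linarith) hp2 X Y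
  rw [← fromRows_fromCols_eq_fromBlocks, ← schattenSum_conjTranspose hp,
    conjTranspose_fromRows_eq_fromCols_conjTranspose]
  refine (schattenSum_fromCols_le (by linarith) hp2 _ _).trans ?_
  rw [schattenSum_conjTranspose hp, schattenSum_conjTranspose hp]
  exact add_le_add (hcol A B) (hcol C D)

theorem schattenSum_fromBlocks_le_two_rpow_mul {p : ℝ} (hp : 2 ≤ p) (A B C D : Matrix n n ℂ) :
    (toEuclideanLin (fromBlocks A B C D)).schattenSum p ≤ 2 ^ (p - 2) *
      ((toEuclideanLin A).schattenSum p + (toEuclideanLin B).schattenSum p +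
        ((toEuclideanLin C).schattenSum p + (toEuclideanLin D).schattenSum p)) := by
  have hp1 : 1 ≤ p := by linarith
  have hcol : ∀ X Y : Matrix n n ℂ, (toEuclideanLin (fromCols X Y)).schattenSum p ≤
      2 ^ (p / 2 - 1) * ((toEuclideanLin X).schattenSum p + (toEuclideanLin Y).schattenSum p) := by
    intro X Y
    rw [← schattenSum_conjTranspose hp1, conjTranspose_fromCols_eq_fromRows_conjTranspose,
      ← schattenSum_conjTranspose hp1 X, ← schattenSum_conjTranspose hp1 Y]
    exact schattenSum_fromRows_le hp _ _
  -- One factor for splitting rows, one for splitting columns.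
  have e : (2 : ℝ) ^ (p - 2) = 2 ^ (p / 2 - 1) * 2 ^ (p / 2 - 1) := by
    rw [← Real.rpow_add two_pos]; congr 1; ring
  rw [← fromRows_fromCols_eq_fromBlocks, e, mul_assoc, mul_add]
  refine (schattenSum_fromRows_le hp _ _).trans ?_
  gcongr
  · exact hcol A B
  · exact hcol C D

end Matrix

open Matrix

/-! ### Schatten norms and the numerical radius. -/

section SchattenNorm

variable {n : Type*} [Fintype n] [DecidableEq n]

theorem schattenNorm_eq_schattenSum_rpow (p : ℝ) (A : Matrix n n ℂ) :
    schattenNorm p A = (toEuclideanLin A).schattenSum p ^ (1 / p) := by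
  rw [schattenNorm, LinearMap.schattenSum, ← finrank_euclideanSpace (𝕜 := ℂ), Finset.sum_range]

theorem schattenNorm_nonneg (p : ℝ) (A : Matrix n n ℂ) : 0 ≤ schattenNorm p A := by
  rw [schattenNorm_eq_schattenSum_rpow]
  exact Real.rpow_nonneg (LinearMap.schattenSum_nonneg _ _) _

theorem schattenNorm_rpow {p : ℝ} (hp : p ≠ 0) (A : Matrix n n ℂ) :
    schattenNorm p A ^ p = (toEuclideanLin A).schattenSum p := by
  rw [schattenNorm_eq_schattenSum_rpow, one_div,
    Real.rpow_inv_rpow (LinearMap.schattenSum_nonneg _ _) hp]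

theorem schattenNorm_conjTranspose {p : ℝ} (hp : 1 ≤ p) (A : Matrix n n ℂ) :
    schattenNorm p Aᴴ = schattenNorm p A := by
  rw [schattenNorm_eq_schattenSum_rpow, schattenSum_conjTranspose hp,
    schattenNorm_eq_schattenSum_rpow]

theorem schattenNorm_add_le {p : ℝ} (hp : 1 ≤ p) (A B : Matrix n n ℂ) :
    schattenNorm p (A + B) ≤ schattenNorm p A + schattenNorm p B := by
  simp only [schattenNorm_eq_schattenSum_rpow, map_add]
  exact LinearMap.schattenSum_add_rpow_le hp _ _

theorem schattenNorm_smul_le {p : ℝ} (hp : 1 ≤ p) (c : ℂ) (A : Matrix n n ℂ) :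
    schattenNorm p (c • A) ≤ ‖c‖ * schattenNorm p A := by
  have hp0 : 0 < p := by linarith
  rw [← Real.rpow_le_rpow_iff (schattenNorm_nonneg _ _)
    (mul_nonneg (norm_nonneg _) (schattenNorm_nonneg _ _)) hp0,
    Real.mul_rpow (norm_nonneg _) (schattenNorm_nonneg _ _), schattenNorm_rpow hp0.ne',
    schattenNorm_rpow hp0.ne', map_smul]
  exact LinearMap.schattenSum_smul_le hp c _

theorem schattenNorm_half_smul_add_le {p : ℝ} (hp : 1 ≤ p) {z : ℂ} (hz : ‖z‖ = 1)
    (B C : Matrix n n ℂ) :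
    schattenNorm p ((2⁻¹ : ℂ) • (z • B + (z • C)ᴴ)) ≤ (schattenNorm p B + schattenNorm p C) / 2 := by
  have h := schattenNorm_smul_le hp (2⁻¹ : ℂ) (z • B + (z • C)ᴴ)
  have h1 := schattenNorm_add_le hp (z • B) (z • C)ᴴ
  rw [schattenNorm_conjTranspose hp] at h1
  have hB := schattenNorm_smul_le hp z B
  have hC := schattenNorm_smul_le hp z C
  rw [hz] at hB hC
  rw [norm_inv, Complex.norm_ofNat] at h
  linarith

theorem Matrix.coe_realPart {m : Type*} (A : Matrix m m ℂ) :
    (ℜ A : Matrix m m ℂ) = (2⁻¹ : ℂ) • (A + Aᴴ) := by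
  rw [realPart_apply_coe, ← Matrix.star_eq_conjTranspose]
  ext i j
  simp [mul_add]

theorem Matrix.coe_realPart_smul_fromBlocks {m : Type*} (z : ℂ)
    (A B C D : Matrix m m ℂ) :
    (ℜ (z • fromBlocks A B C D) : Matrix (m ⊕ m) (m ⊕ m) ℂ) =
      fromBlocks (ℜ (z • A) : Matrix m m ℂ) ((2⁻¹ : ℂ) • (z • B + (z • C)ᴴ))
        ((2⁻¹ : ℂ) • (z • B + (z • C)ᴴ))ᴴ (ℜ (z • D) : Matrix m m ℂ) := by
  simp only [Matrix.coe_realPart, fromBlocks_smul, fromBlocks_conjTranspose, fromBlocks_add]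
  congr 1
  simp [conjTranspose_smul, add_comm]

theorem schattenNorm_realPart_le {p : ℝ} (hp : 1 ≤ p) (A : Matrix n n ℂ) (θ : ℝ) :
    schattenNorm p (ℜ (Complex.exp (θ * Complex.I) • A) : Matrix n n ℂ) ≤
      schattenNumericalRadius p A := by
  -- A real supremum needs a bounded range; ‖A‖_p bounds it.
  refine le_ciSup (f := fun θ : ℝ =>
    schattenNorm p (ℜ (Complex.exp (θ * Complex.I) • A) : Matrix n n ℂ))
    ⟨schattenNorm p A, ?_⟩ θ
  rintro _ ⟨t, rfl⟩
  have h := schattenNorm_half_smul_add_le hp (Complex.norm_exp_ofReal_mul_I t) A A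
  simp only [Matrix.coe_realPart]
  linarith

theorem schattenNumericalRadius_rpow_le {p : ℝ} (hp : 0 < p) {A : Matrix n n ℂ} {R : ℝ}
    (h : ∀ θ : ℝ, schattenNorm p (ℜ (Complex.exp (θ * Complex.I) • A) : Matrix n n ℂ) ^ p ≤ R) :
    schattenNumericalRadius p A ^ p ≤ R := by
  have hR : 0 ≤ R := (Real.rpow_nonneg (schattenNorm_nonneg _ _) p).trans (h 0)
  have h0 : 0 ≤ schattenNumericalRadius p A :=
    Real.iSup_nonneg fun θ => schattenNorm_nonneg p _
  rw [← Real.le_rpow_inv_iff_of_pos h0 hR hp]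
  refine ciSup_le fun θ => ?_
  rw [Real.le_rpow_inv_iff_of_pos (schattenNorm_nonneg _ _) hR hp]
  exact h θ

theorem schattenSum_blocks_realPart_le {p : ℝ} (hp : 1 ≤ p) (A B C D : Matrix n n ℂ) (θ : ℝ) :
    (toEuclideanLin (ℜ (Complex.exp (θ * Complex.I) • A) : Matrix n n ℂ)).schattenSum p +
      (toEuclideanLin ((2⁻¹ : ℂ) • (Complex.exp (θ * Complex.I) • B +
        (Complex.exp (θ * Complex.I) • C)ᴴ))).schattenSum p +
      ((toEuclideanLin ((2⁻¹ : ℂ) • (Complex.exp (θ * Complex.I) • B +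
        (Complex.exp (θ * Complex.I) • C)ᴴ))ᴴ).schattenSum p +
      (toEuclideanLin (ℜ (Complex.exp (θ * Complex.I) • D) : Matrix n n ℂ)).schattenSum p) ≤
      schattenNumericalRadius p A ^ p + schattenNumericalRadius p D ^ p +
        1 / (2 : ℝ) ^ (p - 1) * (schattenNorm p B + schattenNorm p C) ^ p := by
  have hp0 : 0 < p := by linarith
  have hrad : ∀ X : Matrix n n ℂ,
      (toEuclideanLin (ℜ (Complex.exp (θ * Complex.I) • X) : Matrix n n ℂ)).schattenSum p ≤
        schattenNumericalRadius p X ^ p := fun X => by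
    rw [← schattenNorm_rpow hp0.ne']
    exact Real.rpow_le_rpow (schattenNorm_nonneg _ _) (schattenNorm_realPart_le hp X θ) hp0.le
  have hoff := Real.rpow_le_rpow (schattenNorm_nonneg _ _)
    (schattenNorm_half_smul_add_le hp (Complex.norm_exp_ofReal_mul_I θ) B C) hp0.le
  rw [schattenNorm_rpow hp0.ne',
    Real.div_rpow (add_nonneg (schattenNorm_nonneg _ _) (schattenNorm_nonneg _ _)) two_pos.le] at hoff
  -- The factor 2 counts K and K*, which have equal Schatten sums.
  have e : 1 / (2 : ℝ) ^ (p - 1) * (schattenNorm p B + schattenNorm p C) ^ p =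
      2 * ((schattenNorm p B + schattenNorm p C) ^ p / 2 ^ p) := by
    rw [Real.rpow_sub_one two_ne_zero]
    field_simp
  rw [schattenSum_conjTranspose hp, e]
  linarith [hrad A, hrad D]

end SchattenNorm

theorem theorem1p2 (n : ℕ) (A B C D : Matrix (Fin n) (Fin n) ℂ) :
    (∀ p : ℝ, 2 ≤ p →
      schattenNumericalRadius p (Matrix.fromBlocks A B C D) ^ p ≤
        1 / (2 : ℝ) ^ (2 - p) *
          (schattenNumericalRadius p A ^ p + schattenNumericalRadius p D ^ p +
            1 / (2 : ℝ) ^ (p - 1) * (schattenNorm p B + schattenNorm p C) ^ p)) ∧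
    (∀ p : ℝ, 1 ≤ p → p ≤ 2 →
      schattenNumericalRadius p (Matrix.fromBlocks A B C D) ^ p ≤
        schattenNumericalRadius p A ^ p + schattenNumericalRadius p D ^ p +
          1 / (2 : ℝ) ^ (p - 1) * (schattenNorm p B + schattenNorm p C) ^ p) := by
  refine ⟨fun p hp => ?_, fun p hp hp2 => ?_⟩
  · refine schattenNumericalRadius_rpow_le (by linarith) fun θ => ?_
    rw [schattenNorm_rpow (by linarith), coe_realPart_smul_fromBlocks, one_div,
      ← Real.rpow_neg two_pos.le, neg_sub]
    exact (schattenSum_fromBlocks_le_two_rpow_mul hp _ _ _ _).trans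
      (mul_le_mul_of_nonneg_left (schattenSum_blocks_realPart_le (by linarith) A B C D θ)
        (by positivity))
  · refine schattenNumericalRadius_rpow_le (by linarith) fun θ => ?_
    rw [schattenNorm_rpow (by linarith), coe_realPart_smul_fromBlocks]
    exact (schattenSum_fromBlocks_le hp hp2 _ _ _ _).trans
      (schattenSum_blocks_realPart_le hp A B C D θ)
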